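/- Let $d\ge 1$ and $0<r\le R$. A Delone set in $\mathbb{R}^d$ with parameters $(r,R)$ is a set $X\subset\mathbb{R}^d$ such that $r$ is the largest positive number for which every open ball of radius $r$ contains at most one point of $X$, and $R$ is the smallest positive number for which every closed ball of radius $R$ contains at least one point of $X$. For $\rho>0$, $X$ is called $\rho$-isometric if for all $x,x'\in X$ there is an isometry of $\mathbb{R}^d$ that maps $x$ to $x'$ and maps $\{y\in X:\|y-x\|\le\rho\}$ onto $\{y\in X:\|y-x'\|\le\rho\}$; $X$ is a regular system if for all $x,x'\in X$ there is an isometry of $\mathbb{R}^d$ that maps $x$ to $x'$ and $X$ onto itself. For $x\in X$ let $M_x$ be the set of all $y\in X$ for which there is a finite chain $x=x_0,x_1,\dots,x_m=y$ of points of $X$ with $\|x_{i+1}-x_i\|\le 2r$ for $0\le i<m$. Let $\mathcal{X}=\mathcal{X}(d,r,R)$ be the family of all $2R$-isometric Delone sets $X$ in $\mathbb{R}^d$ with parameters $(r,R)$ such that, for every $x\in X$, the affine hull of $M_x$ is $\mathbb{R}^d$. Let $\hat\rho_d(\mathcal{X})$ be the infimum of all $\rho>0$ such that every $\rho$-isometric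 member of $\mathcal{X}$ is a regular system (with $\hat\rho_d(\mathcal{X})=\infty$ if there is no such $\rho$). **Theorem.** There is a function $B:\mathbb{N}\to\mathbb{R}$, depending on $d$ only, with $B(d)=O(d^2\log_2 d)$ as $d\to\infty$, such that $$\hat\rho_d\big(\mathcal{X}(d,r,R)\big)\le B(d)\,R\qquad\text{for all } d\ge 1 \text{ and all } 0<r\le R.$$ -/

import Mathlib

open scoped ENNReal

/-- `X` is a Delone set in `ℝᵈ` with exact parameters `(r, R)`: `r` is the largest positive number
such that every open ball of radius `r` contains at most one point of `X`, and `R` is the smallest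
positive number such that every closed ball of radius `R` contains at least one point of `X`. -/
structure IsDelone {d : ℕ} (r R : ℝ) (X : Set (EuclideanSpace ℝ (Fin d))) : Prop where
  le : r ≤ R
  packing : IsGreatest
    {s : ℝ | 0 < s ∧ ∀ y : EuclideanSpace ℝ (Fin d), (X ∩ Metric.ball y s).Subsingleton} r
  covering : IsLeast
    {s : ℝ | 0 < s ∧ ∀ y : EuclideanSpace ℝ (Fin d), (X ∩ Metric.closedBall y s).Nonempty} R

/-- The `ρ`-cluster of `X` at `x`. -/
def cluster {d : ℕ} (X : Set (EuclideanSpace ℝ (Fin d))) (x : EuclideanSpace ℝ (Fin d)) (ρ : ℝ) :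
    Set (EuclideanSpace ℝ (Fin d)) :=
  X ∩ Metric.closedBall x ρ

/-- Any two `ρ`-clusters of `X` are equivalent: some isometry of `ℝᵈ` maps the centre to the
centre and the cluster onto the cluster. -/
def IsRhoIsometric {d : ℕ} (ρ : ℝ) (X : Set (EuclideanSpace ℝ (Fin d))) : Prop :=
  ∀ x ∈ X, ∀ x' ∈ X, ∃ g : EuclideanSpace ℝ (Fin d) ≃ᵢ EuclideanSpace ℝ (Fin d),
    g x = x' ∧ g '' cluster X x ρ = cluster X x' ρ

/-- The symmetry group of `X` acts transitively on `X`. -/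
def IsRegularSystem {d : ℕ} (X : Set (EuclideanSpace ℝ (Fin d))) : Prop :=
  ∀ x ∈ X, ∀ x' ∈ X, ∃ g : EuclideanSpace ℝ (Fin d) ≃ᵢ EuclideanSpace ℝ (Fin d),
    g x = x' ∧ g '' X = X

/-- The points of `X` that are `t`-reachable from `x` in at most `k` steps. -/
def reachableIn {d : ℕ} (X : Set (EuclideanSpace ℝ (Fin d))) (t : ℝ)
    (x : EuclideanSpace ℝ (Fin d)) (k : ℕ) : Set (EuclideanSpace ℝ (Fin d)) :=
  {y | ∃ m ≤ k, ∃ p : ℕ → EuclideanSpace ℝ (Fin d), p 0 = x ∧ p m = y ∧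
    (∀ i ≤ m, p i ∈ X) ∧ ∀ i < m, dist (p (i + 1)) (p i) ≤ t}

/-- The set of `t`-reachable points for `x`. -/
def reachable {d : ℕ} (X : Set (EuclideanSpace ℝ (Fin d))) (t : ℝ)
    (x : EuclideanSpace ℝ (Fin d)) : Set (EuclideanSpace ℝ (Fin d)) :=
  ⋃ k : ℕ, reachableIn X t x k

/-- The regularity radius of a family `F` of Delone sets: the infimum of all `ρ > 0` such that
every `ρ`-isometric member of `F` is a regular system. It is `∞` if there is no such `ρ`. -/
noncomputable def regularityRadius {d : ℕ} (F : Set (Set (EuclideanSpace ℝ (Fin d)))) : ℝ≥0∞ :=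
  sInf (ENNReal.ofReal '' {ρ : ℝ | 0 < ρ ∧ ∀ X ∈ F, IsRhoIsometric ρ X → IsRegularSystem X})

/-- The family of `2R`-isometric Delone sets in `ℝᵈ` with exact parameters `(r, R)` for which the
set of `2r`-reachable points of every point affinely spans `ℝᵈ`. -/
def reachableFamily (d : ℕ) (r R : ℝ) : Set (Set (EuclideanSpace ℝ (Fin d))) :=
  {X | IsDelone r R X ∧ IsRhoIsometric (2 * R) X ∧
    ∀ x ∈ X, affineSpan ℝ (reachable X (2 * r) x) = ⊤}

/-! Along the radii `2dR, 2dR + 4R, 2dR + 8R, …` the cluster groups at a point `x` decrease. If two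
consecutive groups coincide and the clusters of the larger radius are equivalent, `X` is regular
(`isRegularSystem_of_clusterGroup_le`). A strict inclusion at least halves the order, so a
repetition occurs within about `log₂` of the order of the first group.

That order has a bound free of `R / r`. While it is not yet maximal, the dimension spanned by the
points reachable in `k` steps of length at most `2r` grows with `k`, so `d` steps span `ℝᵈ`
(`affineSpan_reachableIn_eq_top`). Hence the `2rd`-cluster spans, and by packing it has at most
`(2d+1)^d` points. An isometry is determined by the images of `d + 1` affinely independent points,
so the group has order at most `(2d+1)^(d(d+1))`, whose logarithm is `O(d² log d)`. -/

/-! ### Cluster equivalence as a pointwise condition -/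

/-- `g` respects membership in `X` on the closed ball of radius `ρ` about `x`. -/
def MatchesNear {d : ℕ} (X : Set (EuclideanSpace ℝ (Fin d))) (ρ : ℝ)
    (g : EuclideanSpace ℝ (Fin d) ≃ᵢ EuclideanSpace ℝ (Fin d)) (x : EuclideanSpace ℝ (Fin d)) :
    Prop :=
  ∀ y, dist y x ≤ ρ → (g y ∈ X ↔ y ∈ X)

section MatchesNear

variable {d : ℕ} {X : Set (EuclideanSpace ℝ (Fin d))} {ρ ρ' : ℝ}
  {g h : EuclideanSpace ℝ (Fin d) ≃ᵢ EuclideanSpace ℝ (Fin d)} {x x' y : EuclideanSpace ℝ (Fin d)}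

/-- The right-hand side composes, inverts and restricts without computing images. -/
theorem image_cluster_eq_iff (hg : g x = x') :
    g '' cluster X x ρ = cluster X x' ρ ↔ MatchesNear X ρ g x := by
  subst hg
  constructor
  · intro H y hy
    have h1 : g y ∈ cluster X (g x) ρ ↔ y ∈ cluster X x ρ := by
      rw [← H]; exact g.injective.mem_set_image
    simpa [cluster, hy, g.dist_eq] using h1
  · intro H
    ext z
    obtain ⟨y, rfl⟩ := g.surjective z
    rw [g.injective.mem_set_image]
    simp only [cluster, Set.mem_inter_iff, Metric.mem_closedBall, g.dist_eq]
    exact ⟨fun ⟨a, b⟩ => ⟨(H y b).2 a, b⟩, fun ⟨a, b⟩ => ⟨(H y b).1 a, b⟩⟩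

theorem isRhoIsometric_iff :
    IsRhoIsometric ρ X ↔ ∀ x ∈ X, ∀ x' ∈ X,
      ∃ g : EuclideanSpace ℝ (Fin d) ≃ᵢ EuclideanSpace ℝ (Fin d),
        g x = x' ∧ MatchesNear X ρ g x := by
  refine forall₂_congr fun x _ => forall₂_congr fun x' _ => exists_congr fun g => ?_
  exact and_congr_right fun hg => image_cluster_eq_iff hg

theorem MatchesNear.mono (H : MatchesNear X ρ g x) (hρ : ρ' ≤ ρ) : MatchesNear X ρ' g x :=
  fun y hy => H y (hy.trans hρ)

theorem MatchesNear.mul (Hh : MatchesNear X ρ h (g x)) (Hg : MatchesNear X ρ g x) :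
    MatchesNear X ρ (h * g) x := fun y hy =>
  (Hh (g y) (by rwa [g.dist_eq])).trans (Hg y hy)

theorem MatchesNear.inv (H : MatchesNear X ρ g x) : MatchesNear X ρ g⁻¹ (g x) := fun y hy => by
  obtain ⟨z, rfl⟩ := g.surjective y
  rw [IsometryEquiv.inv_apply_self]
  exact (H z (by rwa [g.dist_eq] at hy)).symm

theorem MatchesNear.of_dist_le (H : MatchesNear X (ρ + ρ') g x) (hy : dist y x ≤ ρ') :
    MatchesNear X ρ g y := fun z hz =>
  H z ((dist_triangle z y x).trans (add_le_add hz hy))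

theorem IsRhoIsometric.mono (H : IsRhoIsometric ρ X) (hρ : ρ' ≤ ρ) : IsRhoIsometric ρ' X := by
  rw [isRhoIsometric_iff] at H ⊢
  intro x hx x' hx'
  obtain ⟨g, hg, hm⟩ := H x hx x' hx'
  exact ⟨g, hg, hm.mono hρ⟩

end MatchesNear

/-! ### Cluster groups and the local criterion for regularity -/

/-- The group of isometries of `ℝᵈ` fixing `x` and mapping the `ρ`-cluster at `x` onto itself. -/
def clusterGroup {d : ℕ} (X : Set (EuclideanSpace ℝ (Fin d))) (x : EuclideanSpace ℝ (Fin d))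
    (ρ : ℝ) : Subgroup (EuclideanSpace ℝ (Fin d) ≃ᵢ EuclideanSpace ℝ (Fin d)) where
  carrier := {g | g x = x ∧ MatchesNear X ρ g x}
  one_mem' := ⟨rfl, fun _ _ => Iff.rfl⟩
  mul_mem' := by
    rintro g h ⟨hg, Hg⟩ ⟨hh, Hh⟩
    refine ⟨by rw [IsometryEquiv.mul_apply, hh, hg], MatchesNear.mul (by rwa [hh]) Hh⟩
  inv_mem' := by
    rintro g ⟨hg, Hg⟩
    refine ⟨?_, by simpa [hg] using Hg.inv⟩
    nth_rewrite 1 [← hg]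
    exact IsometryEquiv.inv_apply_self g x

section LocalCriterion

variable {d : ℕ} {X : Set (EuclideanSpace ℝ (Fin d))} {ρ ρ' R : ℝ}
  {g : EuclideanSpace ℝ (Fin d) ≃ᵢ EuclideanSpace ℝ (Fin d)} {x y : EuclideanSpace ℝ (Fin d)}

theorem mem_clusterGroup : g ∈ clusterGroup X x ρ ↔ g x = x ∧ MatchesNear X ρ g x := Iff.rfl

theorem clusterGroup_anti (hρ : ρ' ≤ ρ) : clusterGroup X x ρ ≤ clusterGroup X x ρ' :=
  fun _ hg => ⟨hg.1, hg.2.mono hρ⟩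

/-- Cluster groups at different points are conjugate under an isometry `k` matching the larger
clusters. -/
theorem clusterGroup_le_of_isRhoIsometric (hρ : ρ ≤ ρ') (hiso : IsRhoIsometric ρ' X) (hx : x ∈ X)
    (hle : clusterGroup X x ρ ≤ clusterGroup X x ρ') (hy : y ∈ X) :
    clusterGroup X y ρ ≤ clusterGroup X y ρ' := by
  obtain ⟨k, rfl, hk⟩ := isRhoIsometric_iff.1 hiso x hx y hy
  intro g hg
  have hgk : (k⁻¹ * (g * k)) ∈ clusterGroup X x ρ := by
    refine ⟨by simp [IsometryEquiv.mul_apply, hg.1], MatchesNear.mul ?_ (hg.2.mul (hk.mono hρ))⟩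
    rw [IsometryEquiv.mul_apply, hg.1]
    exact (hk.mono hρ).inv
  have h2 := (hle hgk).2
  refine ⟨hg.1, ?_⟩
  have h3 : MatchesNear X ρ' (k * (k⁻¹ * (g * k))) x :=
    MatchesNear.mul (by rwa [(hle hgk).1]) h2
  have h4 : MatchesNear X ρ' (k * (k⁻¹ * (g * k)) * k⁻¹) (k x) :=
    MatchesNear.mul (by rwa [IsometryEquiv.inv_apply_self]) hk.inv
  simpa [mul_assoc] using h4

/-- Any two points of a relatively dense set are joined by a chain with steps at most `4 * R`. -/
theorem chain_induction_of_covering (hR : 0 < R)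
    (hcov : ∀ y, (X ∩ Metric.closedBall y R).Nonempty)
    {P : EuclideanSpace ℝ (Fin d) → Prop}
    (step : ∀ y ∈ X, ∀ z ∈ X, dist z y ≤ 4 * R → P y → P z)
    (hx : x ∈ X) (hPx : P x) (hy : y ∈ X) : P y := by
  obtain ⟨n, hn⟩ := exists_nat_ge (dist y x / (2 * R))
  rw [div_le_iff₀ (by positivity)] at hn
  induction n generalizing x with
  | zero => exact step x hx y hy (by push_cast at hn; linarith) hPx
  | succ n ih =>
    by_cases hd : dist y x ≤ 4 * R
    · exact step x hx y hy hd hPx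
    push Not at hd
    have hpos : 0 < dist y x := by linarith
    -- Aim at the point `3R` along the segment from `x` to `y`: a point of `X` within `R` of it is
    -- at most `4R` from `x` and at least `2R` closer to `y`.
    obtain ⟨z, hzX, hz⟩ := hcov (AffineMap.lineMap x y (3 * R / dist y x))
    rw [Metric.mem_closedBall] at hz
    have hx' : dist (AffineMap.lineMap x y (3 * R / dist y x)) x = 3 * R := by
      rw [dist_lineMap_left, dist_comm x y, Real.norm_of_nonneg (by positivity)]
      field_simp
    have hy' : dist y (AffineMap.lineMap x y (3 * R / dist y x)) = dist y x - 3 * R := by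
      rw [dist_comm, dist_lineMap_right, dist_comm x y, Real.norm_of_nonneg]
      · field_simp
      · rw [sub_nonneg, div_le_one hpos]; linarith
    have h1 := dist_triangle z (AffineMap.lineMap x y (3 * R / dist y x)) x
    have h2 := dist_triangle_right y z (AffineMap.lineMap x y (3 * R / dist y x))
    refine ih hzX (step x hx z hzX (by linarith) hPx) ?_
    push_cast at hn
    linarith

/-- A relatively dense set is a regular system as soon as its clusters of radius `ρ + 4 * R` are
equivalent and the cluster group at some point does not shrink between `ρ` and `ρ + 4 * R`. -/
theorem isRegularSystem_of_clusterGroup_le (hR : 0 < R) (hρ : 0 ≤ ρ)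
    (hcov : ∀ y, (X ∩ Metric.closedBall y R).Nonempty)
    (hiso : IsRhoIsometric (ρ + 4 * R) X) (hx : x ∈ X)
    (hle : clusterGroup X x ρ ≤ clusterGroup X x (ρ + 4 * R)) : IsRegularSystem X := by
  intro a ha a' ha'
  obtain ⟨g, rfl, hg⟩ := isRhoIsometric_iff.1 hiso a ha a' ha'
  -- Stated for general `k` because it serves both `g` and `g⁻¹`, one for each inclusion.
  have key : ∀ {k : EuclideanSpace ℝ (Fin d) ≃ᵢ EuclideanSpace ℝ (Fin d)} {b}, b ∈ X →
      MatchesNear X (ρ + 4 * R) k b → ∀ y ∈ X, k y ∈ X := by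
    intro k b hb hk y hy
    have hm : MatchesNear X (ρ + 4 * R) k y := by
      refine chain_induction_of_covering (P := MatchesNear X (ρ + 4 * R) k) hR hcov ?_ hb hk hy
      intro y hy z hz hzy hky
      have hkz : k z ∈ X := (hky z (by linarith)).2 hz
      obtain ⟨h, hhz, hh⟩ := isRhoIsometric_iff.1 hiso z hz (k z) hkz
      have hρR : ρ ≤ ρ + 4 * R := by linarith
      -- The `ρ`-cluster at `z` lies in the larger cluster at `y`, where `k` matches. So `k` differs
      -- from `h` by an element of the `ρ`-group at `z`, which by hypothesis preserves the larger
      -- cluster as well.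
      have hmem : h⁻¹ * k ∈ clusterGroup X z ρ := by
        refine ⟨?_, MatchesNear.mul ?_ (hky.of_dist_le hzy)⟩
        · rw [IsometryEquiv.mul_apply, ← hhz, IsometryEquiv.inv_apply_self]
        · rw [← hhz]; exact (hh.mono hρR).inv
      have hmem' := clusterGroup_le_of_isRhoIsometric hρR hiso hx hle hz hmem
      have := MatchesNear.mul (h := h) (by rw [hmem'.1]; exact hh) hmem'.2
      simpa using this
    exact (hm y (by rw [dist_self]; positivity)).2 hy
  refine ⟨g, rfl, Set.Subset.antisymm ?_ ?_⟩
  · rintro _ ⟨y, hy, rfl⟩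
    exact key ha hg y hy
  · intro y hy
    exact ⟨g⁻¹ y, key ha' hg.inv y hy, IsometryEquiv.apply_inv_self g y⟩

end LocalCriterion

/-! ### Packing bounds and the order of a cluster group -/

section Counting

variable {d : ℕ} {X : Set (EuclideanSpace ℝ (Fin d))} {r R ρ : ℝ} {x y : EuclideanSpace ℝ (Fin d)}

theorem IsDelone.two_mul_le_dist (hX : IsDelone r R X) (hx : x ∈ X) (hy : y ∈ X) (hxy : x ≠ y) :
    2 * r ≤ dist x y := by
  by_contra! hlt
  refine hxy (hX.packing.1.2 (midpoint ℝ x y) ⟨hx, ?_⟩ ⟨hy, ?_⟩)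
  · rw [Metric.mem_ball, dist_left_midpoint, Real.norm_of_nonneg zero_le_two]
    linarith
  · rw [Metric.mem_ball, dist_right_midpoint, Real.norm_of_nonneg zero_le_two]
    linarith

/-- A `2 * r`-separated subset of a closed ball of radius `2 * r * n` in `ℝᵈ` has at most
`(2 * n + 1) ^ d` points. -/
theorem card_le_of_separated_of_dist_le (s : Finset (EuclideanSpace ℝ (Fin d))) (n : ℕ)
    (hr : 0 < r) (hs : ∀ c ∈ s, dist c x ≤ 2 * r * n)
    (hsep : ∀ c ∈ s, ∀ c' ∈ s, c ≠ c' → 2 * r ≤ dist c c') :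
    s.card ≤ (2 * n + 1) ^ d := by
  -- The disjoint `r`-balls about the points lie in the ball of radius `2rn + r = δ`; compare
  -- volumes.
  set δ : ℝ := r * (2 * n + 1) with hδ
  have hδpos : 0 < δ := by positivity
  set μ : MeasureTheory.Measure (EuclideanSpace ℝ (Fin d)) := MeasureTheory.volume
  have hdisj : Set.PairwiseDisjoint (s : Set (EuclideanSpace ℝ (Fin d)))
      fun c => Metric.ball c r := by
    intro c hc c' hc' hne
    exact Metric.ball_disjoint_ball (by linarith [hsep c hc c' hc' hne])
  have hsub : (⋃ c ∈ s, Metric.ball c r) ⊆ Metric.ball x δ := by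
    refine Set.iUnion₂_subset fun c hc => Metric.ball_subset_ball' ?_
    rw [hδ]
    linarith [hs c hc]
  have hI : (s.card : ℝ≥0∞) * ENNReal.ofReal (r ^ d) * μ (Metric.ball 0 1) ≤
      ENNReal.ofReal (δ ^ d) * μ (Metric.ball 0 1) := by
    have := MeasureTheory.measure_mono (μ := μ) hsub
    rw [MeasureTheory.measure_biUnion_finset hdisj fun c _ => measurableSet_ball] at this
    simpa only [μ.addHaar_ball_of_pos _ hr, μ.addHaar_ball_of_pos _ hδpos, Finset.sum_const,
      nsmul_eq_mul, mul_assoc, finrank_euclideanSpace_fin] using this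
  have hJ := (ENNReal.mul_le_mul_iff_left (Metric.measure_ball_pos μ _ zero_lt_one).ne'
    MeasureTheory.measure_ball_lt_top.ne).1 hI
  have hK := ENNReal.toReal_le_of_le_ofReal (pow_nonneg hδpos.le _) hJ
  rw [ENNReal.toReal_mul, ENNReal.toReal_natCast, ENNReal.toReal_ofReal (by positivity), hδ,
    mul_pow, mul_comm] at hK
  exact_mod_cast le_of_mul_le_mul_left hK (by positivity)

theorem IsDelone.finite_cluster (hX : IsDelone r R X) (x : EuclideanSpace ℝ (Fin d)) (n : ℕ) :
    (cluster X x (2 * r * n)).Finite ∧ (cluster X x (2 * r * n)).ncard ≤ (2 * n + 1) ^ d := by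
  have key : ∀ s : Finset (EuclideanSpace ℝ (Fin d)), ↑s ⊆ cluster X x (2 * r * n) →
      s.card ≤ (2 * n + 1) ^ d := fun s hs =>
    card_le_of_separated_of_dist_le s n hX.packing.1.1 (fun c hc => (hs hc).2)
      fun c hc c' hc' hne => hX.two_mul_le_dist (hs hc).1 (hs hc').1 hne
  have hfin : (cluster X x (2 * r * n)).Finite := by
    by_contra hinf
    obtain ⟨s, hs, hcard⟩ := Set.Infinite.exists_subset_card_eq hinf ((2 * n + 1) ^ d + 1)
    have := key s hs
    omega
  refine ⟨hfin, ?_⟩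
  rw [Set.ncard_eq_toFinset_card _ hfin]
  exact key _ (by simp)

/-- The group of a cluster that spans `ℝᵈ` acts faithfully on an affine basis taken from the
cluster. -/
theorem finite_clusterGroup (hfin : (cluster X x ρ).Finite)
    (hspan : affineSpan ℝ (cluster X x ρ) = ⊤) :
    Finite (clusterGroup X x ρ) ∧
      Nat.card (clusterGroup X x ρ) ≤ (cluster X x ρ).ncard ^ (d + 1) := by
  obtain ⟨t, hts, htspan, hind⟩ :=
    exists_affineIndependent ℝ (EuclideanSpace ℝ (Fin d)) (cluster X x ρ)
  rw [hspan] at htspan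
  have htfin : t.Finite := hfin.subset hts
  have := hfin.to_subtype
  let := htfin.fintype
  have hmaps : ∀ g ∈ clusterGroup X x ρ, ∀ y ∈ cluster X x ρ, g y ∈ cluster X x ρ := by
    rintro g ⟨hgx, hg⟩ y ⟨hyX, hy⟩
    refine ⟨(hg y hy).2 hyX, ?_⟩
    rw [Metric.mem_closedBall]
    nth_rewrite 1 [← hgx]
    rwa [g.dist_eq]
  let φ : clusterGroup X x ρ → (t → cluster X x ρ) := fun g y => ⟨g.1 y, hmaps g g.2 y (hts y.2)⟩
  have hφ : Function.Injective φ := by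
    intro g h hgh
    have heq : Set.EqOn (g.1.toRealAffineIsometryEquiv.toAffineEquiv.toAffineMap)
        (h.1.toRealAffineIsometryEquiv.toAffineEquiv.toAffineMap) t := fun y hy => by
      simpa using congrArg Subtype.val (congrFun hgh ⟨y, hy⟩)
    have := AffineMap.ext_on htspan heq
    refine Subtype.ext (IsometryEquiv.ext fun y => ?_)
    simpa using DFunLike.congr_fun this y
  have hcard : Nat.card t = d + 1 := by
    rw [Nat.card_eq_fintype_card]
    simpa only [finrank_euclideanSpace_fin] using
      hind.affineSpan_eq_top_iff_card_eq_finrank_add_one.1 (by rw [Subtype.range_coe, htspan])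
  refine ⟨Finite.of_injective φ hφ, (Nat.card_le_card_of_injective φ hφ).trans ?_⟩
  rw [Nat.card_fun, hcard, Nat.card_coe_set_eq]

end Counting

/-! ### Descending chains of finite groups -/

/-- A descending chain of `N + 1` subgroups of a group of order less than `2 ^ N` has a
repetition. -/
theorem exists_subgroup_le_succ {G : Type*} [Group G] (H : ℕ → Subgroup G) (hH : Antitone H)
    [Finite (H 0)] {N : ℕ} (hN : Nat.card (H 0) < 2 ^ N) : ∃ i < N, H i ≤ H (i + 1) := by
  by_contra! hcon
  have hfin : ∀ i, Finite (H i) := fun i =>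
    Finite.of_injective _ (Subgroup.inclusion_injective (hH (Nat.zero_le i)))
  -- Each strict inclusion has index at least 2.
  have key : ∀ i ≤ N, 2 ^ i * Nat.card (H i) ≤ Nat.card (H 0) := by
    intro i
    induction i with
    | zero => simp
    | succ i ih =>
      intro hi
      refine le_trans ?_ (ih (by omega))
      obtain ⟨k, hk⟩ := Subgroup.card_dvd_of_le (hH (Nat.le_succ i))
      have hpos : 0 < Nat.card (H i) := Nat.card_pos
      have hk2 : 2 ≤ k := by
        by_contra! hlt
        interval_cases k
        · omega
        · exact hcon i (by omega)
            (Subgroup.eq_of_le_of_card_ge (hH (Nat.le_succ i)) (by omega)).ge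
      rw [pow_succ, mul_assoc, hk, mul_comm _ k]
      gcongr
  have := key N le_rfl
  have : 0 < Nat.card (H N) := Nat.card_pos
  nlinarith

/-! ### Dimension growth of reachable sets -/

section Reachable

variable {d : ℕ} {X : Set (EuclideanSpace ℝ (Fin d))} {t ρ : ℝ} {k : ℕ}
  {g : EuclideanSpace ℝ (Fin d) ≃ᵢ EuclideanSpace ℝ (Fin d)} {x y : EuclideanSpace ℝ (Fin d)}

theorem self_mem_reachableIn (hx : x ∈ X) : x ∈ reachableIn X t x k :=
  ⟨0, Nat.zero_le k, fun _ => x, rfl, rfl, fun _ _ => hx, fun i hi => absurd hi (Nat.not_lt_zero i)⟩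

theorem reachableIn_mono : Monotone (reachableIn X t x) := by
  rintro k l hkl y ⟨m, hm, h⟩
  exact ⟨m, hm.trans hkl, h⟩

theorem reachableIn_subset_succ (hx : x ∈ X) (hxy : dist y x ≤ t) :
    reachableIn X t y k ⊆ reachableIn X t x (k + 1) := by
  rintro z ⟨m, hm, p, h0, hpm, hX, hstep⟩
  refine ⟨m + 1, by omega, fun i => Nat.casesOn i x p, rfl, hpm, ?_, ?_⟩
  · rintro (_ | i) hi
    · exact hx
    · exact hX i (by omega)
  · rintro (_ | i) hi
    · simpa [h0] using hxy
    · exact hstep i (by omega)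

theorem dist_le_of_chain (p : ℕ → EuclideanSpace ℝ (Fin d)) {m : ℕ}
    (hstep : ∀ i < m, dist (p (i + 1)) (p i) ≤ t) : ∀ i ≤ m, dist (p i) (p 0) ≤ t * i := by
  intro i
  induction i with
  | zero => simp
  | succ i ih =>
    intro hi
    have h1 := ih (by omega)
    have h2 := hstep i (by omega)
    have h3 := dist_triangle (p (i + 1)) (p i) (p 0)
    push_cast
    linarith

theorem reachableIn_subset_cluster (ht : 0 ≤ t) :
    reachableIn X t x k ⊆ cluster X x (t * k) := by
  rintro y ⟨m, hm, p, rfl, rfl, hX, hstep⟩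
  refine ⟨hX m le_rfl, (dist_le_of_chain p hstep m le_rfl).trans ?_⟩
  gcongr

theorem MatchesNear.image_reachableIn_subset (hg : MatchesNear X ρ g x) (ht : 0 ≤ t)
    (hρ : t * k ≤ ρ) : g '' reachableIn X t x k ⊆ reachableIn X t (g x) k := by
  rintro _ ⟨_, ⟨m, hm, p, rfl, rfl, hX, hstep⟩, rfl⟩
  refine ⟨m, hm, g ∘ p, rfl, rfl, fun i hi => (hg _ ?_).2 (hX i hi), fun i hi => ?_⟩
  · refine (dist_le_of_chain p hstep i hi).trans (le_trans ?_ hρ)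
    gcongr
    exact hi.trans hm
  · rw [Function.comp, Function.comp, g.dist_eq]
    exact hstep i hi

theorem MatchesNear.image_reachableIn (hg : MatchesNear X ρ g x) (ht : 0 ≤ t)
    (hρ : t * k ≤ ρ) : g '' reachableIn X t x k = reachableIn X t (g x) k := by
  refine Set.Subset.antisymm (hg.image_reachableIn_subset ht hρ) fun y hy => ?_
  have := hg.inv.image_reachableIn_subset ht hρ ⟨y, hy, rfl⟩
  rw [IsometryEquiv.inv_apply_self] at this
  exact ⟨g⁻¹ y, this, IsometryEquiv.apply_inv_self g y⟩

theorem finrank_vectorSpan_image_isometryEquiv (s : Set (EuclideanSpace ℝ (Fin d))) :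
    Module.finrank ℝ (vectorSpan ℝ (g '' s)) = Module.finrank ℝ (vectorSpan ℝ s) := by
  have : g '' s = g.toRealAffineIsometryEquiv.toAffineEquiv.toAffineMap '' s := by
    ext; simp
  rw [this, ← AffineMap.map_vectorSpan]
  exact LinearEquiv.finrank_map_eq g.toRealAffineIsometryEquiv.linearIsometryEquiv.toLinearEquiv _

/-- If all clusters of radius `t * (k + 1)` are equivalent and the dimension of the span of the
points reachable in at most `k` steps equals that for `k + 1` steps, then the span has
stabilized. -/
theorem affineSpan_reachableIn_eq_of_finrank_eq (hiso : IsRhoIsometric ρ X) (ht : 0 ≤ t)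
    (hρ : t * (k + 1 : ℕ) ≤ ρ) (hx : x ∈ X)
    (hrank : Module.finrank ℝ (vectorSpan ℝ (reachableIn X t x (k + 1))) ≤
      Module.finrank ℝ (vectorSpan ℝ (reachableIn X t x k))) :
    affineSpan ℝ (reachable X t x) ≤ affineSpan ℝ (reachableIn X t x k) := by
  have hρk : t * k ≤ ρ := le_trans (by gcongr; omega) hρ
  have hsame : ∀ y ∈ X, ∀ j, t * (j : ℕ) ≤ ρ →
      Module.finrank ℝ (vectorSpan ℝ (reachableIn X t y j)) =
      Module.finrank ℝ (vectorSpan ℝ (reachableIn X t x j)) := by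
    intro y hy j hj
    obtain ⟨g, rfl, hg⟩ := isRhoIsometric_iff.1 hiso x hx y hy
    rw [← hg.image_reachableIn ht hj, finrank_vectorSpan_image_isometryEquiv]
  have eq_of : ∀ {s u : Set (EuclideanSpace ℝ (Fin d))}, s ⊆ u → s.Nonempty →
      Module.finrank ℝ (vectorSpan ℝ u) ≤ Module.finrank ℝ (vectorSpan ℝ s) →
      affineSpan ℝ s = affineSpan ℝ u := by
    intro s u hsu hs hle
    refine AffineSubspace.eq_of_direction_eq_of_nonempty_of_le ?_
      ((affineSpan_nonempty ℝ).2 hs) (affineSpan_mono ℝ hsu)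
    rw [direction_affineSpan, direction_affineSpan]
    exact Submodule.eq_of_le_of_finrank_le (vectorSpan_mono ℝ hsu) hle
  -- Both spans lie in the span of the `(k + 1)`-step set at `y` and have its dimension, since these
  -- dimensions do not depend on the point of `X`.
  have hstep : ∀ y ∈ X, ∀ z ∈ X, dist z y ≤ t →
      affineSpan ℝ (reachableIn X t z k) = affineSpan ℝ (reachableIn X t y k) := by
    intro y hy z hz hzy
    have h1 := eq_of (reachableIn_mono (X := X) (t := t) (x := y) (Nat.le_succ k))
      ⟨y, self_mem_reachableIn hy⟩ (by rw [hsame y hy _ hρ, hsame y hy _ hρk]; exact hrank)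
    have h2 := eq_of (reachableIn_subset_succ (X := X) (k := k) hy hzy)
      ⟨z, self_mem_reachableIn hz⟩ (by rw [hsame y hy _ hρ, hsame z hz _ hρk]; exact hrank)
    exact h2.trans h1.symm
  refine affineSpan_le.2 (Set.iUnion_subset fun j => ?_)
  rintro y ⟨m, -, p, rfl, rfl, hX, hch⟩
  have : ∀ i ≤ m, affineSpan ℝ (reachableIn X t (p i) k) =
      affineSpan ℝ (reachableIn X t (p 0) k) := by
    intro i
    induction i with
    | zero => simp
    | succ i ih =>
      intro hi
      exact (hstep _ (hX i (by omega)) _ (hX _ hi) (hch i (by omega))).trans (ih (by omega))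
  rw [← this m le_rfl]
  exact subset_affineSpan ℝ _ (self_mem_reachableIn (hX m le_rfl))

theorem affineSpan_reachableIn_eq_top (hiso : IsRhoIsometric ρ X) (ht : 0 ≤ t)
    (hρ : t * d ≤ ρ) (hx : x ∈ X) (htop : affineSpan ℝ (reachable X t x) = ⊤) :
    affineSpan ℝ (reachableIn X t x d) = ⊤ := by
  by_contra hne
  -- If the dimension failed to grow at some step, the span would already be that of all reachable
  -- points, which is everything.
  have key : ∀ k ≤ d, k ≤ Module.finrank ℝ (vectorSpan ℝ (reachableIn X t x k)) := by
    intro k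
    induction k with
    | zero => simp
    | succ k ih =>
      intro hk
      by_contra! hlt
      have h1 := affineSpan_reachableIn_eq_of_finrank_eq (k := k) hiso ht
        (le_trans (by gcongr) hρ) hx (by have := ih (by omega); omega)
      rw [htop, top_le_iff] at h1
      refine hne (top_le_iff.1 (h1 ▸ affineSpan_mono ℝ (reachableIn_mono (by omega))))
  refine hne ((AffineSubspace.affineSpan_eq_top_iff_vectorSpan_eq_top_of_nonempty ℝ _ _
    ⟨x, self_mem_reachableIn hx⟩).2 (Submodule.eq_top_of_finrank_eq
      (le_antisymm (Submodule.finrank_le _) ?_)))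
  rw [finrank_euclideanSpace_fin]
  exact key d le_rfl

end Reachable

/-! ### The bound and its growth -/

/-- A bound on the length of a descending chain of groups of full-dimensional clusters in `ℝᵈ`. -/
def chainBound (d : ℕ) : ℕ := d * (d + 1) * (Nat.log 2 (2 * d + 1) + 1)

theorem pow_lt_two_pow_chainBound {d : ℕ} (hd : 1 ≤ d) :
    ((2 * d + 1) ^ d) ^ (d + 1) < 2 ^ chainBound d := by
  rw [chainBound, ← pow_mul, mul_comm (d * (d + 1)), pow_mul 2]
  exact Nat.pow_lt_pow_left (Nat.lt_pow_succ_log_self one_lt_two _) (by positivity)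

theorem isRegularSystem_of_mem_reachableFamily {d : ℕ} (hd : 1 ≤ d) {r R : ℝ}
    {X : Set (EuclideanSpace ℝ (Fin d))} (hX : X ∈ reachableFamily d r R)
    (hiso : IsRhoIsometric ((2 * d + 4 * chainBound d) * R) X) : IsRegularSystem X := by
  obtain ⟨hdel, -, hspan⟩ := hX
  have hr : 0 < r := hdel.packing.1.1
  have hR : 0 < R := hdel.covering.1.1
  have hrR : r ≤ R := hdel.le
  have hcov := hdel.covering.1.2
  obtain ⟨x, hx, -⟩ := hcov 0
  have hnn : (0 : ℝ) ≤ 4 * chainBound d * R := by positivity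
  have hle : 2 * r * d ≤ 2 * d * R := by nlinarith [(Nat.cast_nonneg d : (0 : ℝ) ≤ d)]
  have hclu : affineSpan ℝ (cluster X x (2 * r * d)) = ⊤ :=
    top_le_iff.1 (affineSpan_reachableIn_eq_top hiso (by positivity) (by linarith) hx
      (hspan x hx) ▸ affineSpan_mono ℝ (reachableIn_subset_cluster (by positivity)))
  obtain ⟨hfin, hcard⟩ := hdel.finite_cluster x d
  obtain ⟨hGfin, hGcard⟩ := finite_clusterGroup hfin hclu
  -- The chain starts at radius `2dR`, but its first group is estimated through the smaller radius
  -- `2rd`, where the point count does not involve `R / r`.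
  have hsub : clusterGroup X x (2 * d * R + 4 * R * (0 : ℕ)) ≤ clusterGroup X x (2 * r * d) :=
    clusterGroup_anti (by simpa using hle)
  have hfin0 : Finite (clusterGroup X x (2 * d * R + 4 * R * (0 : ℕ))) :=
    Finite.of_injective _ (Subgroup.inclusion_injective hsub)
  obtain ⟨i, hi, hGi⟩ := exists_subgroup_le_succ (N := chainBound d)
    (fun i : ℕ => clusterGroup X x (2 * d * R + 4 * R * i))
    (fun i j hij => clusterGroup_anti (by gcongr))
    (lt_of_le_of_lt ((Nat.card_le_card_of_injective _ (Subgroup.inclusion_injective hsub)).trans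
      (hGcard.trans (Nat.pow_le_pow_left hcard _))) (pow_lt_two_pow_chainBound hd))
  have hstep : 2 * d * R + 4 * R * ((i + 1 : ℕ) : ℝ) = 2 * d * R + 4 * R * i + 4 * R := by
    push_cast; ring
  rw [hstep] at hGi
  refine isRegularSystem_of_clusterGroup_le hR (by positivity) hcov (hiso.mono ?_) hx hGi
  have : ((i + 1 : ℕ) : ℝ) ≤ chainBound d := by exact_mod_cast hi
  rw [← hstep]
  nlinarith

theorem isBigO_two_mul_add_chainBound :
    (fun d : ℕ => (2 * d + 4 * chainBound d : ℝ)) =O[Filter.atTop]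
      fun d : ℕ => (d : ℝ) ^ 2 * Real.logb 2 (d : ℝ) := by
  -- With `l = log₂ d`, `26 = 2 + 4 · 6` comes from `d ≤ d² l` and `chainBound d ≤ 6 d² l`; `d ≥ 3`
  -- ensures `2d + 1 ≤ d²`.
  refine Asymptotics.IsBigO.of_bound 26 (Filter.eventually_atTop.2 ⟨3, fun d hd => ?_⟩)
  have hd3 : (3 : ℝ) ≤ d := by exact_mod_cast hd
  set l := Real.logb 2 (d : ℝ) with hl
  have hl1 : 1 ≤ l := by
    rw [hl, Real.le_logb_iff_rpow_le one_lt_two (by linarith)]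
    norm_num; linarith
  have hlog : (Nat.log 2 (2 * d + 1) : ℝ) ≤ 2 * l := by
    have h1 : (Nat.log 2 (2 * d + 1) : ℝ) ≤ Real.logb 2 ((2 * d + 1 : ℕ) : ℝ) := by
      exact_mod_cast Real.natLog_le_logb (2 * d + 1) 2
    have h2 : Real.logb 2 ((2 * d + 1 : ℕ) : ℝ) ≤ Real.logb 2 ((d : ℝ) ^ 2) :=
      Real.logb_le_logb_of_le one_lt_two (by positivity) (by push_cast; nlinarith)
    rw [Real.logb_pow] at h2
    exact_mod_cast h1.trans h2
  have hc : (chainBound d : ℝ) ≤ 2 * (d : ℝ) ^ 2 * (3 * l) := by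
    rw [chainBound]
    push_cast
    have h3 : (d : ℝ) * (d + 1) ≤ 2 * (d : ℝ) ^ 2 := by nlinarith
    exact mul_le_mul h3 (by linarith) (by positivity) (by positivity)
  rw [Real.norm_of_nonneg (by positivity), Real.norm_of_nonneg (by positivity)]
  have h4 : (d : ℝ) ≤ (d : ℝ) ^ 2 * l := by
    nlinarith [mul_nonneg (sq_nonneg (d : ℝ)) (sub_nonneg.2 hl1)]
  nlinarith

theorem theorem4p1 :
    ∃ B : ℕ → ℝ,
      Asymptotics.IsBigO Filter.atTop B (fun d : ℕ => (d : ℝ) ^ 2 * Real.logb 2 (d : ℝ)) ∧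
      ∀ d : ℕ, 1 ≤ d → ∀ r R : ℝ, 0 < r → r ≤ R →
        regularityRadius (reachableFamily d r R) ≤ ENNReal.ofReal (B d * R) := by
  refine ⟨fun d => 2 * d + 4 * chainBound d, isBigO_two_mul_add_chainBound, ?_⟩
  intro d hd r R hr hrR
  have hd' : (1 : ℝ) ≤ d := by exact_mod_cast hd
  have hR : 0 < R := hr.trans_le hrR
  exact sInf_le ⟨_, ⟨by positivity, fun X hX hiso =>
    isRegularSystem_of_mem_reachableFamily hd hX hiso⟩, rfl⟩
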